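/- Let $\gamma\in(0,1]$, $\epsilon\in\left(0,\frac{1}{\gamma+1}\right)$ and $T>0$. There is a constant $c_{\gamma,\epsilon,T}>0$, depending only on $\gamma$, $\epsilon$ and $T$, with the following property. Let $(\mathsf H_i)_{i\in\mathbb N^+}$ be a sequence of Hurst parameters in $\left(\frac12,1\right)$ whose infimum $\underline{\mathsf H}:=\inf_{i\in\mathbb N^+}\mathsf H_i$ satisfies $\underline{\mathsf H}\in\left(\frac1{\gamma+1},1\right)$. Let $(B^{\mathsf H_i}(t))_{t\ge 0}$, $i\in\mathbb N^+$, be independent one-dimensional fractional Brownian motions on a probability space $(\Omega,\mathcal F,\mathbb P)$, that is, centered Gaussian processes with a.s. continuous paths and covariance $\mathbb E\big(B^{\mathsf H_i}(s)B^{\mathsf H_i}(t)\big)=\frac12\big(s^{2\mathsf H_i}+t^{2\mathsf H_i}-|s-t|^{2\mathsf H_i}\big)$. Then for every $i\in\mathbb N^+$ there exists a positive, $\mathbb P$-a.s. finite random variable $\Theta_{i,\epsilon,T}$ such that, $\mathbb P$-a.s., the inequality $$\left|B^{\mathsf H_i}(t^*)-B^{\mathsf H_i}(t)\right|\le c_{\gamma,\epsilon,T}\,\Theta_{i,\epsilon,T}\,|t^*-t|^{\underline{\mathsf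 H}-\epsilon}$$ holds for all $t,t^*\in[0,T]$. Moreover, $$\sup_{i\in\mathbb N^+}\mathbb E\left|\Theta_{i,\epsilon,T}\right|^p<+\infty$$ for every $p\in[1,+\infty)$. -/

import Mathlib

open MeasureTheory ProbabilityTheory
open scoped NNReal ENNReal

/-- A real-valued process `B = (B t)_{t ≥ 0}` on `(Ω, P)` is a (standard, one-dimensional) fractional
Brownian motion with Hurst parameter `H`: a centered Gaussian process with almost surely continuous
paths and covariance `E (B s * B t) = (s ^ (2 H) + t ^ (2 H) - |s - t| ^ (2 H)) / 2`.
For `H > 0` the covariance at `s = t = 0` says `E (B 0 ^ 2) = 0`, so the process starts almost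
surely at the origin. -/
structure IsFractionalBrownianMotion {Ω : Type*} [MeasurableSpace Ω] (P : Measure Ω) (H : ℝ)
    (B : ℝ≥0 → Ω → ℝ) : Prop where
  gaussian : IsGaussianProcess B P
  centered : ∀ t : ℝ≥0, ∫ ω, B t ω ∂P = 0
  covariance_eq : ∀ s t : ℝ≥0, ∫ ω, B s ω * B t ω ∂P =
    ((s : ℝ) ^ (2 * H) + (t : ℝ) ^ (2 * H) - |(s : ℝ) - (t : ℝ)| ^ (2 * H)) / 2
  continuous_paths : ∀ᵐ ω ∂P, Continuous fun t : ℝ≥0 => B t ω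

/-! Kolmogorov–Chentsov chaining, kept uniform in the Hurst parameter. Write `h` for the infimum and
take `Θ i` to be the maximum of 1 and the dyadic Hölder seminorm of order `h - ε` of the path. For a
continuous path, finiteness of this seminorm implies the Hölder bound on all of `[0, T]`
(`abs_sub_le_of_dyadic_increments`).

For the moments, bound the `q`-th power of the supremum by a sum over all dyadic increments. Since
`H i ≥ h`, each of the `2 ^ n` weighted Gaussian increments at level `n` has `q`-th moment of order
`2 ^ (-n ε q)`, with a constant independent of `i`. The sum converges once `ε q > 1`; smaller
exponents follow from larger ones. -/

theorem abs_sub_le_of_dyadic_increments {g : ℝ → ℝ} (hg : Continuous g) {A a : ℝ} (hA : 0 ≤ A)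
    (ha : 0 < a) (ha1 : a ≤ 1)
    (hinc : ∀ n k : ℕ, k < 2 ^ n →
      |g ((k + 1 : ℕ) / 2 ^ n) - g (k / 2 ^ n)| ≤ A * ((2 : ℝ) ^ (-a)) ^ n)
    {x y : ℝ} (hx : x ∈ Set.Icc (0 : ℝ) 1) (hy : y ∈ Set.Icc (0 : ℝ) 1) :
    |g y - g x| ≤ 6 / (1 - (2 : ℝ) ^ (-a)) * A * |y - x| ^ a := by
  set r : ℝ := (2 : ℝ) ^ (-a) with hr
  have hr0 : 0 < r := by positivity
  have hr1 : r < 1 := Real.rpow_lt_one_of_one_lt_of_neg (by norm_num) (by linarith)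
  have h1r : 0 < 1 - r := by linarith
  wlog hxy : x ≤ y generalizing x y
  · rw [abs_sub_comm, abs_sub_comm y]
    exact this hy hx (le_of_not_ge hxy)
  rcases hxy.eq_or_lt with rfl | hlt
  · simp [Real.zero_rpow ha.ne']
  have hfloor_le : ∀ {z : ℝ}, z ∈ Set.Icc (0 : ℝ) 1 → ∀ n : ℕ, ⌊2 ^ n * z⌋₊ ≤ 2 ^ n := by
    intro z hz n
    have : 2 ^ n * z ≤ ((2 ^ n : ℕ) : ℝ) := by
      push_cast
      exact mul_le_of_le_one_right (by positivity) hz.2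
    exact (Nat.floor_le_floor this).trans (by rw [Nat.floor_natCast])
  have happrox : ∀ {z : ℝ}, z ∈ Set.Icc (0 : ℝ) 1 → ∀ n : ℕ,
      |g (⌊2 ^ n * z⌋₊ / 2 ^ n) - g z| ≤ A * r ^ n / (1 - r) := by
    intro z hz n
    have hlim : Filter.Tendsto (fun n : ℕ => g (⌊2 ^ n * z⌋₊ / 2 ^ n)) Filter.atTop
        (nhds (g z)) := by
      refine (hg.tendsto z).comp ?_
      have h := (tendsto_nat_floor_mul_div_atTop hz.1).comp
        (tendsto_pow_atTop_atTop_of_one_lt (one_lt_two (α := ℝ)))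
      refine h.congr fun n => ?_
      simp [mul_comm]
    -- Successive dyadic floors of `z` agree or differ by one increment at the finer level, so the
    -- telescoping series is geometric.
    refine dist_le_of_le_geometric_of_tendsto r A hr1 (fun m => ?_) hlim n
    have hz0 : 0 ≤ 2 ^ m * z := mul_nonneg (by positivity) hz.1
    set j := ⌊2 ^ m * z⌋₊ with hj
    have hj1 : (j : ℝ) ≤ 2 ^ m * z := Nat.floor_le hz0
    have hj2 : 2 ^ m * z < j + 1 := Nat.lt_floor_add_one _
    have hk0 : 0 ≤ 2 ^ (m + 1) * z := mul_nonneg (by positivity) hz.1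
    have hkle := hfloor_le hz (m + 1)
    set k := ⌊2 ^ (m + 1) * z⌋₊ with hk
    have hk1 : (k : ℝ) ≤ 2 ^ (m + 1) * z := Nat.floor_le hk0
    have hk2 : 2 ^ (m + 1) * z < k + 1 := Nat.lt_floor_add_one _
    have hpow : (2 : ℝ) ^ (m + 1) * z = 2 * (2 ^ m * z) := by ring
    rw [hpow] at hk1 hk2
    have h1 : k < 2 * j + 2 := by
      have : (k : ℝ) < 2 * j + 2 := by linarith
      exact_mod_cast this
    have h2 : 2 * j < k + 1 := by
      have : (2 : ℝ) * j < k + 1 := by linarith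
      exact_mod_cast this
    have hjeq : (j : ℝ) / 2 ^ m = (2 * j : ℕ) / 2 ^ (m + 1) := by
      push_cast
      rw [pow_succ]
      field_simp
    rw [hjeq]
    obtain h | h : k = 2 * j ∨ k = 2 * j + 1 := by omega
    · rw [h, dist_self]
      positivity
    · rw [h, dist_comm, Real.dist_eq]
      refine (hinc (m + 1) (2 * j) (by omega)).trans ?_
      gcongr A * ?_
      exact pow_le_pow_of_le_one hr0.le hr1.le (Nat.le_succ m)
  -- The scale with `2 ^ (-(n+1)) < y - x ≤ 2 ^ (-n)`: the level-`n` floors of `x` and `y` are then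
  -- equal or adjacent.
  obtain ⟨n, hn1, hn2⟩ := exists_nat_pow_near_of_lt_one (x := y - x) (y := (1 / 2 : ℝ))
    (by linarith) (by linarith [hx.1, hy.2]) (by norm_num) (by norm_num)
  have hmid : |g (⌊2 ^ n * y⌋₊ / 2 ^ n) - g (⌊2 ^ n * x⌋₊ / 2 ^ n)| ≤ A * r ^ n := by
    have hx0 : 0 ≤ 2 ^ n * x := mul_nonneg (by positivity) hx.1
    have hle : ⌊2 ^ n * x⌋₊ ≤ ⌊2 ^ n * y⌋₊ := Nat.floor_le_floor (by gcongr)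
    have hle' : ⌊2 ^ n * y⌋₊ ≤ ⌊2 ^ n * x⌋₊ + 1 := by
      rw [← Nat.floor_add_one hx0]
      refine Nat.floor_le_floor ?_
      have : (2 : ℝ) ^ n * (y - x) ≤ 2 ^ n * (1 / 2) ^ n := by gcongr
      rw [← mul_pow] at this
      norm_num at this
      linarith
    have := hfloor_le hy n
    obtain h | h : ⌊2 ^ n * y⌋₊ = ⌊2 ^ n * x⌋₊ ∨ ⌊2 ^ n * y⌋₊ = ⌊2 ^ n * x⌋₊ + 1 := by omega
    · rw [h, sub_self, abs_zero]
      positivity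
    · rw [h]
      exact hinc n _ (by omega)
  have hX := happrox hx n
  have hY := happrox hy n
  have htri : |g y - g x| ≤ 3 / (1 - r) * A * r ^ n := by
    have h3 : A * r ^ n ≤ A * r ^ n / (1 - r) :=
      le_div_self (by positivity) h1r (by linarith)
    have h4 : 3 / (1 - r) * A * r ^ n = 3 * (A * r ^ n / (1 - r)) := by ring
    rw [h4]
    rw [abs_le] at hX hY hmid ⊢
    constructor <;> linarith
  refine htri.trans ?_
  -- Passing from `n` to `n + 1` costs `1 / r ≤ 2`, because `a ≤ 1`; this turns the 3 into 6.
  have hrn : r ^ n ≤ 2 * |y - x| ^ a := by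
    rw [abs_of_pos (by linarith)]
    have h5 : ((1 / 2 : ℝ) ^ (n + 1)) ^ a ≤ (y - x) ^ a :=
      Real.rpow_le_rpow (by positivity) hn1.le ha.le
    have h6 : ((1 / 2 : ℝ) ^ (n + 1)) ^ a = r ^ (n + 1) := by
      rw [one_div, inv_pow, Real.inv_rpow (by positivity), hr, Real.rpow_neg (by norm_num), inv_pow,
        Real.rpow_pow_comm (by norm_num)]
    have h7 : 1 ≤ 2 * r := by
      have : (2 : ℝ) ^ (-1 : ℝ) ≤ r := Real.rpow_le_rpow_of_exponent_le (by norm_num) (by linarith)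
      rw [Real.rpow_neg_one] at this
      linarith
    calc r ^ n = 1 * r ^ n := (one_mul _).symm
      _ ≤ 2 * r * r ^ n := by gcongr
      _ = 2 * r ^ (n + 1) := by ring
      _ ≤ _ := by rw [← h6]; gcongr
  calc 3 / (1 - r) * A * r ^ n ≤ 3 / (1 - r) * A * (2 * |y - x| ^ a) := by gcongr
    _ = _ := by ring

/-! ### Absolute moments of centered Gaussians -/

theorem lintegral_enorm_rpow_of_hasGaussianLaw {Ω : Type*} [MeasurableSpace Ω] {P : Measure Ω}
    {X : Ω → ℝ} (hX : HasGaussianLaw X P) (hmean : ∫ ω, X ω ∂P = 0) {σ : ℝ} (hσ : 0 ≤ σ)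
    (hvar : ∫ ω, X ω ^ 2 ∂P = σ ^ 2) {q : ℝ} (hq : 0 ≤ q) :
    ∫⁻ ω, ‖X ω‖ₑ ^ q ∂P = ENNReal.ofReal σ ^ q * ∫⁻ x, ‖x‖ₑ ^ q ∂(gaussianReal 0 1) := by
  have := hX.isProbabilityMeasure
  have hv : Var[X; P] = σ ^ 2 := by
    rw [variance_of_integral_eq_zero hX.aemeasurable hmean, ← hvar]
  have hmap : P.map X = (gaussianReal 0 1).map (σ * ·) := by
    rw [hX.map_eq_gaussianReal, gaussianReal_map_const_mul, hv, hmean]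
    congr 1
    · simp
    · ext
      simp [Real.coe_toNNReal _ (sq_nonneg σ)]
  have hmeas : Measurable fun x : ℝ => ‖x‖ₑ ^ q := by fun_prop
  rw [← lintegral_map' (f := fun x : ℝ => ‖x‖ₑ ^ q) hmeas.aemeasurable hX.aemeasurable, hmap,
    lintegral_map hmeas (by fun_prop), ← lintegral_const_mul _ hmeas]
  refine lintegral_congr fun x => ?_
  rw [enorm_mul, ENNReal.mul_rpow_of_nonneg _ _ hq, Real.enorm_eq_ofReal hσ]

theorem lintegral_enorm_rpow_gaussianReal_lt_top {q : ℝ} (hq : 0 < q) :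
    ∫⁻ x, ‖x‖ₑ ^ q ∂(gaussianReal 0 1) < ∞ := by
  have h := memLp_id_gaussianReal' (μ := 0) (v := 1) (ENNReal.ofReal q) ENNReal.ofReal_ne_top
  have := lintegral_rpow_enorm_lt_top_of_eLpNorm_lt_top (by simpa using hq)
    ENNReal.ofReal_ne_top h.2
  simpa [ENNReal.toReal_ofReal hq.le] using this

/-! ### Dyadic Hölder seminorm and its moments for fractional Brownian motion -/

/-- The dyadic Hölder seminorm of order `a` of `f` on `[0, T]`. -/
noncomputable def dyadicHolder (a : ℝ) (T : ℝ≥0) (f : ℝ≥0 → ℝ) : ℝ≥0∞ :=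
  ⨆ n : ℕ, ⨆ k : Fin (2 ^ n), ENNReal.ofReal (((2 : ℝ) ^ a) ^ n) *
    ‖f (T * ((k + 1 : ℕ) / 2 ^ n)) - f (T * ((k : ℕ) / 2 ^ n))‖ₑ

theorem abs_sub_le_dyadicHolder {f : ℝ≥0 → ℝ} (hf : Continuous f) {a : ℝ} (ha : 0 < a)
    (ha1 : a ≤ 1) {T : ℝ≥0} (hT : 0 < T) (hD : dyadicHolder a T f ≠ ∞) {t t' : ℝ≥0}
    (ht : t ≤ T) (ht' : t' ≤ T) :
    |f t' - f t| ≤ 6 / (1 - (2 : ℝ) ^ (-a)) * (dyadicHolder a T f).toReal *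
      (|(t' : ℝ) - t| / T) ^ a := by
  have hT' : (0 : ℝ) < T := hT
  set g : ℝ → ℝ := fun x => f (T * x.toNNReal) with hg
  have hgd : ∀ n k : ℕ, g (k / 2 ^ n) = f (T * (k / 2 ^ n)) := by
    intro n k
    have : ((k : ℝ) / 2 ^ n).toNNReal = k / 2 ^ n := by
      rw [← Real.toNNReal_coe (r := (k : ℝ≥0) / 2 ^ n)]
      push_cast
      rfl
    simp only [hg, this]
  have hgt : ∀ s : ℝ≥0, g (s / T) = f s := by
    intro s
    have : ((s : ℝ) / T).toNNReal = s / T := by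
      rw [← NNReal.coe_div, Real.toNNReal_coe]
    simp only [hg, this, mul_div_cancel₀ s hT.ne']
  have hmem : ∀ s : ℝ≥0, s ≤ T → (s : ℝ) / T ∈ Set.Icc (0 : ℝ) 1 := fun s hs =>
    ⟨by positivity, (div_le_one hT').2 (by exact_mod_cast hs)⟩
  have key := abs_sub_le_of_dyadic_increments (g := g) (by fun_prop)
    (A := (dyadicHolder a T f).toReal) ENNReal.toReal_nonneg ha ha1 (fun n k hk => ?_)
    (hmem t ht) (hmem t' ht')
  · rwa [hgt, hgt, ← sub_div, abs_div, abs_of_pos hT'] at key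
  · have hle : ENNReal.ofReal (((2 : ℝ) ^ a) ^ n) *
        ‖f (T * ((k + 1 : ℕ) / 2 ^ n)) - f (T * ((k : ℕ) / 2 ^ n))‖ₑ ≤ dyadicHolder a T f :=
      le_iSup₂_of_le n ⟨k, hk⟩ le_rfl
    have hle' := ENNReal.toReal_mono hD hle
    rw [ENNReal.toReal_mul, ENNReal.toReal_ofReal (by positivity), toReal_enorm,
      Real.norm_eq_abs] at hle'
    rw [hgd, hgd, Real.rpow_neg (by norm_num), inv_pow, ← div_eq_mul_inv,
      le_div_iff₀ (by positivity), mul_comm]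
    exact hle'

theorem aemeasurable_dyadicHolder {Ω : Type*} [MeasurableSpace Ω] {P : Measure Ω}
    {B : ℝ≥0 → Ω → ℝ} (hB : ∀ t, AEMeasurable (B t) P) (a : ℝ) (T : ℝ≥0) :
    AEMeasurable (fun ω => dyadicHolder a T fun t => B t ω) P := by
  unfold dyadicHolder
  exact AEMeasurable.iSup fun n => AEMeasurable.iSup fun k =>
    ((hB _).sub (hB _)).enorm.const_mul _

theorem IsFractionalBrownianMotion.lintegral_enorm_sub_rpow {Ω : Type*} [MeasurableSpace Ω]
    {P : Measure Ω} {H : ℝ} {B : ℝ≥0 → Ω → ℝ} (hB : IsFractionalBrownianMotion P H B)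
    (hH : 0 < H) (s t : ℝ≥0) {q : ℝ} (hq : 0 ≤ q) :
    ∫⁻ ω, ‖B t ω - B s ω‖ₑ ^ q ∂P =
      ENNReal.ofReal (|(t : ℝ) - s| ^ H) ^ q * ∫⁻ x, ‖x‖ₑ ^ q ∂(gaussianReal 0 1) := by
  have hL : ∀ u, MemLp (B u) 2 P := fun u => (hB.gaussian.hasGaussianLaw_eval u).memLp_two
  have hI : ∀ u, Integrable (B u) P := fun u => (hB.gaussian.hasGaussianLaw_eval u).integrable
  have hM : ∀ u v, Integrable (fun ω => B u ω * B v ω) P := fun u v => (hL u).integrable_mul (hL v)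
  refine lintegral_enorm_rpow_of_hasGaussianLaw hB.gaussian.hasGaussianLaw_fun_sub ?_
    (by positivity) ?_ hq
  · rw [integral_sub (hI t) (hI s), hB.centered, hB.centered, sub_zero]
  · have hexp : ∀ ω, (B t ω - B s ω) ^ 2 =
        B t ω * B t ω - 2 * (B t ω * B s ω) + B s ω * B s ω := fun ω => by ring
    simp_rw [hexp]
    have hdiff : Integrable (fun ω => B t ω * B t ω - 2 * (B t ω * B s ω)) P :=
      (hM t t).sub ((hM t s).const_mul 2)
    rw [integral_add hdiff (hM s s),
      integral_sub (hM t t) ((hM t s).const_mul 2), integral_const_mul, hB.covariance_eq,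
      hB.covariance_eq, hB.covariance_eq]
    have h2 : |(t : ℝ) - s| ^ (2 * H) = (|(t : ℝ) - s| ^ H) ^ 2 := by
      rw [mul_comm, Real.rpow_mul (abs_nonneg _), Real.rpow_two]
    rw [← h2]
    simp only [sub_self, abs_zero, Real.zero_rpow (by positivity : 2 * H ≠ 0)]
    ring

/-- The supremum is replaced by a sum: `2 ^ n` terms at level `n`, each contributing a factor `2 ^
(-n ε q)`. The right-hand side is free of `H`, which gives uniformity in `i`. -/
theorem IsFractionalBrownianMotion.lintegral_dyadicHolder_rpow_le {Ω : Type*} [MeasurableSpace Ω]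
    {P : Measure Ω} {H : ℝ} {B : ℝ≥0 → Ω → ℝ} (hB : IsFractionalBrownianMotion P H B)
    (hH : 0 < H) (hH1 : H ≤ 1) {h ε q : ℝ} (hh : h ≤ H) (hq : 0 < q) (T : ℝ≥0) :
    ∫⁻ ω, dyadicHolder (h - ε) T (fun t => B t ω) ^ q ∂P ≤
      ENNReal.ofReal (max (1 : ℝ) T) ^ q * (∫⁻ x, ‖x‖ₑ ^ q ∂(gaussianReal 0 1)) *
        ∑' n : ℕ, ENNReal.ofReal ((2 : ℝ) ^ (1 - ε * q)) ^ n := by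
  set C := ∫⁻ x, ‖x‖ₑ ^ q ∂(gaussianReal 0 1)
  set M := ENNReal.ofReal (max (1 : ℝ) T)
  have hmeas : ∀ u, AEMeasurable (B u) P := fun u => hB.gaussian.aemeasurable u
  have hsup : ∀ ω, dyadicHolder (h - ε) T (fun t => B t ω) ^ q ≤
      ∑' n : ℕ, ∑ k : Fin (2 ^ n), (ENNReal.ofReal (((2 : ℝ) ^ (h - ε)) ^ n) *
        ‖B (T * ((k + 1 : ℕ) / 2 ^ n)) ω - B (T * ((k : ℕ) / 2 ^ n)) ω‖ₑ) ^ q := by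
    intro ω
    rw [← ENNReal.le_rpow_inv_iff hq]
    refine iSup₂_le fun n k => ?_
    rw [ENNReal.le_rpow_inv_iff hq]
    refine le_trans ?_ (ENNReal.le_tsum n)
    exact Finset.single_le_sum (f := fun k : Fin (2 ^ n) =>
      (ENNReal.ofReal (((2 : ℝ) ^ (h - ε)) ^ n) *
        ‖B (T * ((k + 1 : ℕ) / 2 ^ n)) ω - B (T * ((k : ℕ) / 2 ^ n)) ω‖ₑ) ^ q)
      (fun _ _ => zero_le) (Finset.mem_univ k)
  have hincr : ∀ n (k : Fin (2 ^ n)), AEMeasurable (fun ω =>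
      (ENNReal.ofReal (((2 : ℝ) ^ (h - ε)) ^ n) *
        ‖B (T * ((k + 1 : ℕ) / 2 ^ n)) ω - B (T * ((k : ℕ) / 2 ^ n)) ω‖ₑ) ^ q) P := fun n k =>
    (((hmeas _).sub (hmeas _)).enorm.const_mul _).pow_const q
  have hsum : ∀ n, AEMeasurable (fun ω => ∑ k : Fin (2 ^ n),
      (ENNReal.ofReal (((2 : ℝ) ^ (h - ε)) ^ n) *
        ‖B (T * ((k + 1 : ℕ) / 2 ^ n)) ω - B (T * ((k : ℕ) / 2 ^ n)) ω‖ₑ) ^ q) P := fun n =>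
    Finset.aemeasurable_fun_sum _ fun k _ => hincr n k
  refine (lintegral_mono hsup).trans ?_
  rw [lintegral_tsum hsum, ← ENNReal.tsum_mul_left]
  refine ENNReal.tsum_le_tsum fun n => ?_
  rw [lintegral_finsetSum' _ fun k _ => hincr n k]
  have hdist : ∀ k : ℕ, |((T * ((k + 1 : ℕ) / 2 ^ n) : ℝ≥0) : ℝ) - (T * (k / 2 ^ n) : ℝ≥0)| ^ H ≤
      max (1 : ℝ) T * ((2 : ℝ) ^ (-h)) ^ n := by
    intro k
    have h1 : ((T * ((k + 1 : ℕ) / 2 ^ n) : ℝ≥0) : ℝ) - (T * (k / 2 ^ n) : ℝ≥0) =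
        T * (2 ^ n)⁻¹ := by
      push_cast
      ring
    rw [h1, abs_of_nonneg (by positivity), Real.mul_rpow (by positivity) (by positivity)]
    -- `H ≤ 1` removes the dependence on `H` from the scaling factor.
    have h2 : (T : ℝ) ^ H ≤ max (1 : ℝ) T := by
      calc (T : ℝ) ^ H ≤ (max (1 : ℝ) T) ^ H := by gcongr; exact le_max_right _ _
        _ ≤ (max (1 : ℝ) T) ^ (1 : ℝ) := Real.rpow_le_rpow_of_exponent_le (le_max_left _ _) hH1
        _ = _ := Real.rpow_one _
    have h3 : ((2 ^ n : ℝ)⁻¹) ^ H ≤ ((2 : ℝ) ^ (-h)) ^ n := by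
      rw [Real.inv_rpow (by positivity), ← Real.rpow_pow_comm (by norm_num), ← inv_pow,
        ← Real.rpow_neg (by norm_num)]
      gcongr
      norm_num
    gcongr
  have hterm : ∀ k : Fin (2 ^ n), ∫⁻ ω, (ENNReal.ofReal (((2 : ℝ) ^ (h - ε)) ^ n) *
        ‖B (T * ((k + 1 : ℕ) / 2 ^ n)) ω - B (T * ((k : ℕ) / 2 ^ n)) ω‖ₑ) ^ q ∂P ≤
      M ^ q * C * ENNReal.ofReal ((2 : ℝ) ^ (-(ε * q))) ^ n := by
    intro k
    simp_rw [ENNReal.mul_rpow_of_nonneg _ _ hq.le]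
    have hincr' : AEMeasurable (fun ω =>
        ‖B (T * ((k + 1 : ℕ) / 2 ^ n)) ω - B (T * ((k : ℕ) / 2 ^ n)) ω‖ₑ ^ q) P :=
      ((hmeas _).sub (hmeas _)).enorm.pow_const q
    rw [lintegral_const_mul'' _ hincr',
      hB.lintegral_enorm_sub_rpow hH _ _ hq.le, ← mul_assoc,
      ← ENNReal.mul_rpow_of_nonneg _ _ hq.le, ← ENNReal.ofReal_mul (by positivity)]
    have h4 : ((2 : ℝ) ^ (h - ε)) ^ n *
        |((T * (((k : ℕ) + 1 : ℕ) / 2 ^ n) : ℝ≥0) : ℝ) - (T * ((k : ℕ) / 2 ^ n) : ℝ≥0)| ^ H ≤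
        max (1 : ℝ) T * ((2 : ℝ) ^ (-ε)) ^ n := by
      calc _ ≤ ((2 : ℝ) ^ (h - ε)) ^ n * (max (1 : ℝ) T * ((2 : ℝ) ^ (-h)) ^ n) := by
            gcongr
            exact hdist k
        _ = max (1 : ℝ) T * ((2 : ℝ) ^ (h - ε) * (2 : ℝ) ^ (-h)) ^ n := by rw [mul_pow]; ring
        _ = _ := by
          rw [← Real.rpow_add (by norm_num)]
          congr 3
          ring
    calc _ ≤ ENNReal.ofReal (max (1 : ℝ) T * ((2 : ℝ) ^ (-ε)) ^ n) ^ q * C := by gcongr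
      _ = _ := by
        rw [ENNReal.ofReal_mul (by positivity), ENNReal.mul_rpow_of_nonneg _ _ hq.le,
          ENNReal.ofReal_rpow_of_nonneg (x := ((2 : ℝ) ^ (-ε)) ^ n) (by positivity) hq.le,
          ← Real.rpow_pow_comm (by positivity), ← Real.rpow_mul (by norm_num), neg_mul,
          ENNReal.ofReal_pow (by positivity)]
        ring
  calc _ ≤ ∑ _k : Fin (2 ^ n), M ^ q * C * ENNReal.ofReal ((2 : ℝ) ^ (-(ε * q))) ^ n :=
        Finset.sum_le_sum fun k _ => hterm k
    _ = _ := by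
      rw [Finset.sum_const, Finset.card_univ, Fintype.card_fin, nsmul_eq_mul, sub_eq_add_neg,
        Real.rpow_add (by norm_num), Real.rpow_one, ENNReal.ofReal_mul (by norm_num), mul_pow]
      norm_num
      ring

/-! ### Uniform Hölder constants and moments -/

theorem lemmaA2 (γ : ℝ) (hγ : γ ∈ Set.Ioc (0 : ℝ) 1) (ε : ℝ) (hε : ε ∈ Set.Ioo 0 (1 / (γ + 1)))
    (T : ℝ≥0) (hT : 0 < T) :
    ∃ c : ℝ, 0 < c ∧
      ∀ (Ω : Type*) [MeasurableSpace Ω] (P : Measure Ω) [IsProbabilityMeasure P]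
        (H : ℕ+ → ℝ) (B : ℕ+ → ℝ≥0 → Ω → ℝ),
        (∀ i, H i ∈ Set.Ioo (1 / 2 : ℝ) 1) →
        (⨅ i, H i) ∈ Set.Ioo (1 / (γ + 1)) 1 →
        (∀ i, IsFractionalBrownianMotion P (H i) (B i)) →
        iIndepFun (fun i ω t => B i t ω) P →
        ∃ Θ : ℕ+ → Ω → ℝ,
          (∀ i, Measurable (Θ i)) ∧
          (∀ i ω, 0 < Θ i ω) ∧
          (∀ i, ∀ᵐ ω ∂P, ∀ t ∈ Set.Icc 0 T, ∀ t' ∈ Set.Icc 0 T,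
            |B i t' ω - B i t ω| ≤ c * Θ i ω * |(t' : ℝ) - (t : ℝ)| ^ ((⨅ j, H j) - ε)) ∧
          ∀ p : ℝ, 1 ≤ p → ⨆ i, ∫⁻ ω, ENNReal.ofReal (|Θ i ω| ^ p) ∂P < ∞ := by
  obtain ⟨hε0, hε1⟩ := hε
  have hγ0 : 0 < 1 / (γ + 1) := by
    have := hγ.1
    positivity
  -- A lower bound for the order `h - ε` that does not involve `H`, so the chaining constant depends
  -- only on `γ`, `ε`; the factor `max 1 T⁻¹` absorbs the rescaling of `[0, T]` to `[0, 1]`.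
  set b : ℝ := 1 / (γ + 1) - ε with hb
  have hb0 : 0 < b := by linarith
  have hrb : (2 : ℝ) ^ (-b) < 1 := Real.rpow_lt_one_of_one_lt_of_neg (by norm_num) (by linarith)
  have hc : 0 < 6 / (1 - (2 : ℝ) ^ (-b)) * max 1 (T : ℝ)⁻¹ :=
    mul_pos (div_pos (by norm_num) (by linarith)) (lt_max_of_lt_left one_pos)
  refine ⟨6 / (1 - (2 : ℝ) ^ (-b)) * max 1 (T : ℝ)⁻¹, hc, ?_⟩
  intro Ω _ P _ H B hH hinf hB _
  set h := ⨅ i, H i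
  have hle : ∀ i, h ≤ H i := ciInf_le ⟨1 / 2, by rintro _ ⟨i, rfl⟩; exact (hH i).1.le⟩
  have hH0 : ∀ i, 0 < H i := fun i => by linarith [(hH i).1]
  have ha : b < h - ε := by linarith [hinf.1]
  have ha1 : h - ε ≤ 1 := by linarith [hinf.2]
  have hmeas : ∀ i, AEMeasurable (fun ω => dyadicHolder (h - ε) T fun t => B i t ω) P := fun i =>
    aemeasurable_dyadicHolder (fun t => (hB i).gaussian.aemeasurable t) _ _
  have hmoment : ∀ q : ℝ, 1 < ε * q → ∃ K : ℝ≥0∞, K < ∞ ∧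
      ∀ i, ∫⁻ ω, dyadicHolder (h - ε) T (fun t => B i t ω) ^ q ∂P ≤ K := by
    intro q hq
    have hq0 : 0 < q := pos_of_mul_pos_right (one_pos.trans hq) hε0.le
    refine ⟨_, ?_, fun i => (hB i).lintegral_dyadicHolder_rpow_le (hH0 i) (hH i).2.le (hle i) hq0 T⟩
    refine ENNReal.mul_lt_top (ENNReal.mul_lt_top ?_
      (lintegral_enorm_rpow_gaussianReal_lt_top hq0)) ?_
    · exact ENNReal.rpow_lt_top_of_nonneg hq0.le ENNReal.ofReal_ne_top
    · rw [ENNReal.tsum_geometric, ENNReal.inv_lt_top, tsub_pos_iff_lt, ENNReal.ofReal_lt_one]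
      exact Real.rpow_lt_one_of_one_lt_of_neg (by norm_num) (by linarith)
  have hfin : ∀ i, ∀ᵐ ω ∂P, dyadicHolder (h - ε) T (fun t => B i t ω) < ∞ := by
    intro i
    have hq : 1 < ε * (2 / ε) := by
      rw [mul_div_cancel₀ _ hε0.ne']
      norm_num
    obtain ⟨K, hK, hKi⟩ := hmoment (2 / ε) hq
    filter_upwards [ae_lt_top' ((hmeas i).pow_const _) ((hKi i).trans_lt hK).ne] with ω hω
    exact (ENNReal.rpow_lt_top_iff_of_pos (by positivity)).1 hω
  -- The seminorm is only a.e. measurable, hence the version `mk`. The maximum with 1 gives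
  -- positivity and makes powers monotone in the exponent.
  refine ⟨fun i ω => max 1 ((hmeas i).mk _ ω).toReal,
    fun i => measurable_const.max (hmeas i).measurable_mk.ennreal_toReal,
    fun i ω => lt_max_of_lt_left one_pos, fun i => ?_, fun p hp => ?_⟩
  · filter_upwards [hfin i, (hmeas i).ae_eq_mk, (hB i).continuous_paths] with ω hω hmk hcont
    intro t ht t' ht'
    rw [← hmk]
    refine (abs_sub_le_dyadicHolder hcont (hb0.trans ha) ha1 hT hω.ne ht.2 ht'.2).trans ?_
    rw [Real.div_rpow (abs_nonneg _) T.coe_nonneg, div_eq_mul_inv (_ ^ _), ← Real.inv_rpow T.coe_nonneg]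
    have h1 : ((T : ℝ)⁻¹) ^ (h - ε) ≤ max 1 (T : ℝ)⁻¹ := by
      calc ((T : ℝ)⁻¹) ^ (h - ε) ≤ (max 1 (T : ℝ)⁻¹) ^ (h - ε) :=
            Real.rpow_le_rpow (by positivity) (le_max_right _ _) (by linarith)
        _ ≤ (max 1 (T : ℝ)⁻¹) ^ (1 : ℝ) := Real.rpow_le_rpow_of_exponent_le (le_max_left _ _) ha1
        _ = _ := Real.rpow_one _
    have h2 : 6 / (1 - (2 : ℝ) ^ (-(h - ε))) ≤ 6 / (1 - (2 : ℝ) ^ (-b)) := by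
      have : (2 : ℝ) ^ (-(h - ε)) ≤ 2 ^ (-b) :=
        Real.rpow_le_rpow_of_exponent_le (by norm_num) (by linarith)
      exact div_le_div_of_nonneg_left (by norm_num) (by linarith) (by linarith)
    have h3 : 0 ≤ 6 / (1 - (2 : ℝ) ^ (-b)) := div_nonneg (by norm_num) (by linarith)
    set D := (dyadicHolder (h - ε) T fun t => B i t ω).toReal
    calc 6 / (1 - (2 : ℝ) ^ (-(h - ε))) * D * (|(t' : ℝ) - t| ^ (h - ε) * (T : ℝ)⁻¹ ^ (h - ε))
        ≤ 6 / (1 - (2 : ℝ) ^ (-b)) * max 1 D *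
          (|(t' : ℝ) - t| ^ (h - ε) * max 1 (T : ℝ)⁻¹) := by
          gcongr
          exact le_max_right _ _
      _ = _ := by ring
  -- Raising `p` to at least `2 / ε` ensures `ε q ≥ 2 > 1`, where the dyadic sum converges.
  · obtain ⟨K, hK, hKi⟩ := hmoment (max p (2 / ε)) (by
      calc (1 : ℝ) < ε * (2 / ε) := by
            rw [mul_div_cancel₀ _ hε0.ne']
            norm_num
        _ ≤ _ := by gcongr; exact le_max_right _ _)
    set q := max p (2 / ε)
    have hpq : p ≤ q := le_max_left _ _
    have hq0 : 0 < q := by linarith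
    refine (iSup_le fun i => ?_).trans_lt (ENNReal.add_lt_top.2 ⟨ENNReal.one_lt_top, hK⟩)
    calc ∫⁻ ω, ENNReal.ofReal (|max 1 ((hmeas i).mk _ ω).toReal| ^ p) ∂P
        ≤ ∫⁻ ω, 1 + dyadicHolder (h - ε) T (fun t => B i t ω) ^ q ∂P := by
          refine lintegral_mono_ae ?_
          filter_upwards [hfin i, (hmeas i).ae_eq_mk] with ω hω hmk
          rw [← hmk]
          set D := dyadicHolder (h - ε) T (fun t => B i t ω)
          have h1 : 1 ≤ max 1 D.toReal := le_max_left _ _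
          rw [abs_of_pos (one_pos.trans_le h1)]
          calc ENNReal.ofReal (max 1 D.toReal ^ p) ≤ ENNReal.ofReal (max 1 D.toReal ^ q) :=
                ENNReal.ofReal_le_ofReal (Real.rpow_le_rpow_of_exponent_le h1 hpq)
            _ = max 1 D ^ q := by
              rw [← ENNReal.ofReal_rpow_of_nonneg (by positivity) hq0.le, ENNReal.ofReal_max,
                ENNReal.ofReal_one, ENNReal.ofReal_toReal hω.ne]
            _ ≤ 1 + D ^ q := by
              rcases max_choice 1 D with h | h <;> rw [h]
              · rw [ENNReal.one_rpow]
                exact le_self_add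
              · exact le_add_self
      _ = 1 + ∫⁻ ω, dyadicHolder (h - ε) T (fun t => B i t ω) ^ q ∂P := by
        rw [lintegral_add_left measurable_const, lintegral_one, measure_univ]
      _ ≤ 1 + K := by
        gcongr
        exact hKi i
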